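/- Let $\Gamma$ be a simple graph (no loops, possibly infinite) with vertex set $\Lambda$. For each $I\in\Lambda$ let $(G_I,P_I)$ be a quasi-lattice ordered group: $G_I$ is a group, $P_I\subseteq G_I$ is a submonoid with $P_I\cap P_I^{-1}=\{1\}$, and for the left-invariant partial order $x\le y\iff x^{-1}y\in P_I$ every nonempty finite subset of $G_I$ with an upper bound in $G_I$ has a least upper bound in $G_I$. Let $(G,P)=\Gamma_{I\in\Lambda}(G_I,P_I)$ be the graph product: $G$ is the quotient of the free product $*_{I\in\Lambda}G_I$ by the smallest normal subgroup containing $xyx^{-1}y^{-1}$ for all $x\in G_I$, $y\in G_J$ with $I,J$ adjacent in $\Gamma$, and $P$ is the submonoid of $G$ generated by the images of the $P_I$; again $x\le y$ means $x^{-1}y\in P$. Let $\bigoplus_{I\in\Lambda}(G_I,P_I)$ be the direct sum, that is, the group of finitely supported families $(g_I)_{I\in\Lambda}\in\prod_{I}G_I$ with the componentwise order (positive cone: all $g_I\in P_I$). Let $\phi:G\to\bigoplus_{I\in\Lambda}G_I$ be the group homomorphism that is the identity on each factor $G_I$. Then $\phi$ is order preserving: $x\le y$ implies $\phi(x)\le\phi(y)$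 for all $x,y\in G$. Moreover, whenever $x,y\in P$ have a common upper bound in $P$, the following hold: (a) $\phi(x)=\phi(y)$ only if $x=y$; (b) $x$ and $y$ have a unique least upper bound $x\vee y$ in $G$, $\phi(x)$ and $\phi(y)$ have a unique least upper bound $\phi(x)\vee\phi(y)$ in $\bigoplus_{I\in\Lambda}G_I$, and $\phi(x)\vee\phi(y)=\phi(x\vee y)$. -/

import Mathlib

universe u v

section PartiallyOrderedGroups

variable {G : Type u} [Group G]

/-- The left-invariant relation `x ≤ y ↔ x⁻¹ y ∈ P` determined by a submonoid `P` of a group. -/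
def ConeLE (P : Submonoid G) (x y : G) : Prop := x⁻¹ * y ∈ P

/-- `z` is an upper bound of `S` for the order with positive cone `P`. -/
def IsConeUpperBound (P : Submonoid G) (S : Set G) (z : G) : Prop :=
  ∀ s ∈ S, ConeLE P s z

/-- `z` is a least upper bound, among all elements of the group, of `S` for the order
with positive cone `P`. -/
def IsConeLUB (P : Submonoid G) (S : Set G) (z : G) : Prop :=
  IsConeUpperBound P S z ∧ ∀ w, IsConeUpperBound P S w → ConeLE P z w

/-- `(G, P)` is a partially ordered group: `P ∩ P⁻¹ = {1}`. -/
def IsPositiveCone (P : Submonoid G) : Prop := ∀ x, x ∈ P → x⁻¹ ∈ P → x = 1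

/-- `(G, P)` is quasi-lattice ordered: it is a partially ordered group in which every nonempty
finite set with an upper bound in `G` has a least upper bound in `G`. -/
structure IsQuasiLatticeOrdered (P : Submonoid G) : Prop where
  isPositiveCone : IsPositiveCone P
  exists_lub : ∀ S : Set G, S.Finite → S.Nonempty → (∃ z, IsConeUpperBound P S z) →
    ∃ z, IsConeLUB P S z

theorem ConeLE.trans {P : Submonoid G} {x y z : G} (h : ConeLE P x y) (h' : ConeLE P y z) :
    ConeLE P x z := by
  have := P.mul_mem h h'
  simpa [ConeLE, mul_assoc] using this

/-- It suffices to consider pairs in the definition of a quasi-lattice order. -/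
theorem isQuasiLatticeOrdered_iff_pair {P : Submonoid G} :
    IsQuasiLatticeOrdered P ↔ IsPositiveCone P ∧
      ∀ x y, (∃ z, ConeLE P x z ∧ ConeLE P y z) → ∃ z, IsConeLUB P {x, y} z := by
  constructor
  · intro h
    refine ⟨h.isPositiveCone, fun x y ⟨z, hx, hy⟩ => ?_⟩
    refine h.exists_lub {x, y} (by simp) (by simp) ⟨z, ?_⟩
    rintro s (rfl | rfl)
    exacts [hx, hy]
  · rintro ⟨h1, h2⟩
    refine ⟨h1, fun S hS hne => ?_⟩
    induction S, hS using Set.Finite.induction_on with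
    | empty => simp at hne
    | @insert a S _ _ ih =>
      rintro ⟨z, hz⟩
      rcases S.eq_empty_or_nonempty with rfl | hne'
      · refine ⟨a, ?_, fun w hw => hw a (by simp)⟩
        rintro s (rfl | hs)
        · simp [ConeLE, P.one_mem]
        · exact absurd hs (by simp)
      · have hzS : IsConeUpperBound P S z := fun s hs => hz s (Set.mem_insert_of_mem _ hs)
        obtain ⟨m, hm⟩ := ih hne' ⟨z, hzS⟩
        obtain ⟨j, hj⟩ := h2 a m ⟨z, hz a (Set.mem_insert _ _), hm.2 z hzS⟩
        refine ⟨j, ?_, fun w hw => hj.2 w ?_⟩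
        · rintro s (rfl | hs)
          · exact hj.1 _ (by simp)
          · exact (hm.1 s hs).trans (hj.1 m (by simp))
        · rintro s (rfl | rfl)
          · exact hw _ (Set.mem_insert _ _)
          · exact hm.2 w fun s hs => hw s (Set.mem_insert_of_mem _ hs)

end PartiallyOrderedGroups

section GraphProducts

variable {V : Type u} (Γ : SimpleGraph V) (G : V → Type v) [∀ i, Group (G i)]

/-- The elements `x y x⁻¹ y⁻¹` of the free product, for `x` and `y` in factors at
adjacent vertices. -/
def graphProductRels : Set (Monoid.CoprodI G) :=
  {r | ∃ i j, Γ.Adj i j ∧ ∃ (x : G i) (y : G j),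
    r = Monoid.CoprodI.of x * Monoid.CoprodI.of y * (Monoid.CoprodI.of x)⁻¹ *
      (Monoid.CoprodI.of y)⁻¹}

/-- The graph product over `Γ` of the groups `G i`: the quotient of their free product by the
smallest normal subgroup containing the commutators of elements of adjacent factors. -/
abbrev GraphProduct : Type (max u v) :=
  Monoid.CoprodI G ⧸ Subgroup.normalClosure (graphProductRels Γ G)

/-- The canonical homomorphism of a factor into the graph product. -/
def GraphProduct.of (i : V) : G i →* GraphProduct Γ G :=
  (QuotientGroup.mk' _).comp Monoid.CoprodI.of

/-- The positive cone of the graph product: the submonoid generated by the union of the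
positive cones of the factors. -/
def GraphProduct.cone (P : ∀ i, Submonoid (G i)) : Submonoid (GraphProduct Γ G) :=
  Submonoid.closure (⋃ i, GraphProduct.of Γ G i '' (P i : Set (G i)))

/-- The direct sum of a family of (not necessarily commutative) groups: the finitely supported
elements of the full product. -/
def GroupDirectSum : Subgroup (∀ i, G i) where
  carrier := {f | {i | f i ≠ 1}.Finite}
  one_mem' := by simp
  mul_mem' {f g} hf hg := by
    refine (hf.union hg).subset fun i hi => ?_
    by_contra h
    simp only [Set.mem_union, Set.mem_ofPred_eq, not_or, not_not] at h
    exact hi (by simp [h.1, h.2])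
  inv_mem' {f} hf := by simpa using hf

/-- The positive cone of the direct sum, giving the componentwise order. -/
def GroupDirectSum.cone (P : ∀ i, Submonoid (G i)) : Submonoid (GroupDirectSum G) where
  carrier := {f | ∀ i, (f : ∀ i, G i) i ∈ P i}
  one_mem' := fun i => (P i).one_mem
  mul_mem' hf hg := fun i => (P i).mul_mem (hf i) (hg i)

open Classical in
/-- The canonical embedding of a factor into the direct sum. -/
noncomputable def GroupDirectSum.single (i : V) : G i →* GroupDirectSum G :=
  (MonoidHom.mulSingle G i).codRestrict (GroupDirectSum G) fun x => by
    refine (Set.finite_singleton i).subset fun j hj => ?_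
    by_contra h
    exact hj (Pi.mulSingle_eq_of_ne h x)

theorem GroupDirectSum.single_commute {i j : V} (h : i ≠ j) (x : G i) (y : G j) :
    Commute (GroupDirectSum.single G i x) (GroupDirectSum.single G j y) := by
  classical
  apply Subtype.ext
  exact (Pi.mulSingle_commute h x y).eq

/-- The canonical homomorphism from the graph product to the direct sum, which is the identity
on each factor. -/
noncomputable def GraphProduct.toDirectSum : GraphProduct Γ G →* GroupDirectSum G :=
  QuotientGroup.lift _ (Monoid.CoprodI.lift (GroupDirectSum.single G)) <| by
    refine Subgroup.normalClosure_le_normal (N := MonoidHom.ker _) ?_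
    rintro _ ⟨i, j, hij, x, y, rfl⟩
    have h := (GroupDirectSum.single_commute G hij.ne x y).eq
    simp only [SetLike.mem_coe, MonoidHom.mem_ker, map_mul, map_inv, Monoid.CoprodI.lift_of]
    rw [h]
    group

theorem GraphProduct.toDirectSum_of (i : V) (x : G i) :
    GraphProduct.toDirectSum Γ G (GraphProduct.of Γ G i x) = GroupDirectSum.single G i x := by
  simp [GraphProduct.toDirectSum, GraphProduct.of]

end GraphProducts

/-! A letter at `i` can be moved to the front of a positive word only past letters at vertices
adjacent to `i`. To extract this movable part without normal forms, map the graph product to a free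
product of two copies of the direct sum (`splitAt`): the link of `i` dies and `i` is separated from
its non-neighbours. The first syllable gives `head`. Positive letters never cancel in the direct
sum, so for positive `w` an element `x` of the factor at `i` lies below `w` iff `x ≤ head i w`
(`of_coneLE_iff`).

Bounded letters thus have explicit joins: the join in the factor at equal vertices, the product at
adjacent ones; otherwise one letter is trivial. The same formulas give joins in the direct sum, and
the complements are again letters. Such squares can therefore be pasted along words
(`IsPreservedLUB.mul_left`), giving joins preserved by the homomorphism. Separation follows because
a positive element with trivial image is trivial. -/

open Monoid

/-! ### Least upper bounds under translation -/

section ConeOrder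

variable {H : Type*} [Group H] {C : Submonoid H}

theorem isConeUpperBound_pair {x y z : H} :
    IsConeUpperBound C {x, y} z ↔ ConeLE C x z ∧ ConeLE C y z := by
  simp [IsConeUpperBound]

theorem isConeLUB_pair {x y z : H} :
    IsConeLUB C {x, y} z ↔ ConeLE C x z ∧ ConeLE C y z ∧
      ∀ w, ConeLE C x w → ConeLE C y w → ConeLE C z w := by
  simp [IsConeLUB, isConeUpperBound_pair, and_assoc]

theorem ConeLE.refl (C : Submonoid H) (x : H) : ConeLE C x x := by
  simp [ConeLE, C.one_mem]

theorem coneLE_mul_right (x : H) {p : H} (hp : p ∈ C) : ConeLE C x (x * p) := by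
  simpa [ConeLE] using hp

theorem one_coneLE {x : H} : ConeLE C 1 x ↔ x ∈ C := by
  simp [ConeLE]

theorem coneLE_mul_left_iff {g x y : H} : ConeLE C (g * x) y ↔ ConeLE C x (g⁻¹ * y) := by
  simp [ConeLE, mul_assoc]

theorem ConeLE.mem {x y : H} (h : ConeLE C x y) (hx : x ∈ C) : y ∈ C := by
  simpa using C.mul_mem hx h

theorem IsPositiveCone.antisymm (hC : IsPositiveCone C) {x y : H} (h : ConeLE C x y)
    (h' : ConeLE C y x) : x = y := by
  have := hC (x⁻¹ * y) h (by simpa [ConeLE] using h')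
  rwa [inv_mul_eq_one] at this

theorem IsPositiveCone.eq_one_of_mul_eq_one (hC : IsPositiveCone C) {x y : H} (hx : x ∈ C)
    (hy : y ∈ C) (h : x * y = 1) : x = 1 :=
  hC x hx (by rwa [inv_eq_of_mul_eq_one_right h])

theorem IsPositiveCone.isConeLUB_iff_eq (hC : IsPositiveCone C) {S : Set H} {z : H}
    (hz : IsConeLUB C S z) (w : H) : IsConeLUB C S w ↔ w = z :=
  ⟨fun hw => hC.antisymm (hw.2 z hz.1) (hz.2 w hw.1), fun h => h ▸ hz⟩

theorem isConeLUB_one_left {y : H} (hy : y ∈ C) : IsConeLUB C {1, y} y :=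
  isConeLUB_pair.2 ⟨one_coneLE.2 hy, .refl C y, fun _ _ h => h⟩

theorem IsConeLUB.pair_comm {x y z : H} (h : IsConeLUB C {x, y} z) : IsConeLUB C {y, x} z := by
  rwa [Set.pair_comm]

/-- If `a * b` is the least upper bound of `a` and `y`, then least upper bounds of `a * x` and
`y` are obtained from those of `x` and `b` by translation. -/
theorem IsConeLUB.mul_left {a x y b z : H} (hx : x ∈ C) (h : IsConeLUB C {a, y} (a * b))
    (h' : IsConeLUB C {x, b} z) : IsConeLUB C {a * x, y} (a * z) := by
  rw [isConeLUB_pair] at *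
  obtain ⟨-, h2, h3⟩ := h
  obtain ⟨k1, k2, k3⟩ := h'
  refine ⟨by simpa [ConeLE, mul_assoc] using k1,
    h2.trans (by simpa [ConeLE, mul_assoc] using k2), fun w h4 h5 => ?_⟩
  -- As `x` is positive, a bound of `a * x` also bounds `a`, hence `a * b`.
  have h6 := h3 w ((coneLE_mul_right a hx).trans h4) h5
  rw [coneLE_mul_left_iff] at *
  exact k3 _ h4 h6

end ConeOrder

/-! ### Joins in the direct sum -/

section DirectSum

variable {V : Type u} {G : V → Type v} [∀ i, Group (G i)] {P : ∀ i, Submonoid (G i)}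

@[simp]
theorem GroupDirectSum.single_apply_same (i : V) (x : G i) :
    (GroupDirectSum.single G i x : ∀ i, G i) i = x := by
  classical
  exact Pi.mulSingle_eq_same i x

theorem GroupDirectSum.single_apply_of_ne {i j : V} (h : j ≠ i) (x : G i) :
    (GroupDirectSum.single G i x : ∀ i, G i) j = 1 := by
  classical
  exact Pi.mulSingle_eq_of_ne h x

theorem GroupDirectSum.single_mem_cone {i : V} {x : G i} (hx : x ∈ P i) :
    GroupDirectSum.single G i x ∈ GroupDirectSum.cone G P := by
  intro j
  by_cases h : j = i
  · subst h; simpa using hx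
  · rw [single_apply_of_ne h]; exact (P j).one_mem

theorem GroupDirectSum.isPositiveCone (hP : ∀ i, IsPositiveCone (P i)) :
    IsPositiveCone (GroupDirectSum.cone G P) := by
  intro x hx hx'
  ext i
  exact hP i _ (hx i) (hx' i)

theorem GroupDirectSum.coneLE_iff {x y : GroupDirectSum G} :
    ConeLE (GroupDirectSum.cone G P) x y ↔
      ∀ i, ConeLE (P i) ((x : ∀ i, G i) i) ((y : ∀ i, G i) i) :=
  Iff.rfl

theorem GroupDirectSum.single_coneLE_iff {i : V} {x : G i} {y : GroupDirectSum G} :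
    ConeLE (GroupDirectSum.cone G P) (GroupDirectSum.single G i x) y ↔
      ConeLE (P i) x ((y : ∀ i, G i) i) ∧ ∀ j, j ≠ i → (y : ∀ i, G i) j ∈ P j := by
  rw [coneLE_iff]
  constructor
  · refine fun h => ⟨by simpa using h i, fun j hj => ?_⟩
    simpa [single_apply_of_ne hj, one_coneLE] using h j
  · rintro ⟨h1, h2⟩ j
    by_cases h : j = i
    · subst h; simpa using h1
    · rw [single_apply_of_ne h, one_coneLE]; exact h2 j h

/-- Coordinate `i` would factor 1 into two positive elements. This absence of cancellation drives
all later arguments on positive words. -/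
theorem GroupDirectSum.single_mul_ne_one (hP : ∀ i, IsPositiveCone (P i)) {i : V} {x : G i}
    (hx : x ∈ P i) (hx1 : x ≠ 1) {d : GroupDirectSum G} (hd : d ∈ GroupDirectSum.cone G P) :
    GroupDirectSum.single G i x * d ≠ 1 := by
  intro h
  refine hx1 ((hP i).eq_one_of_mul_eq_one hx (hd i) ?_)
  simpa using congrArg (fun f : GroupDirectSum G => (f : ∀ i, G i) i) h

theorem GroupDirectSum.isConeLUB_single_same {i : V} {x y z : G i}
    (h : IsConeLUB (P i) {x, y} z) :
    IsConeLUB (GroupDirectSum.cone G P)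
      {GroupDirectSum.single G i x, GroupDirectSum.single G i y}
      (GroupDirectSum.single G i z) := by
  rw [isConeLUB_pair] at *
  simp only [single_coneLE_iff, single_apply_same]
  have h1 : ∀ j, j ≠ i → (GroupDirectSum.single G i z : ∀ i, G i) j ∈ P j := fun j hj => by
    rw [single_apply_of_ne hj]; exact (P j).one_mem
  exact ⟨⟨h.1, h1⟩, ⟨h.2.1, h1⟩, fun w hx hy => ⟨h.2.2 _ hx.1 hy.1, hx.2⟩⟩

theorem GroupDirectSum.isConeLUB_single_of_ne {i j : V} (hij : i ≠ j) {x : G i} {y : G j}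
    (hx : x ∈ P i) (hy : y ∈ P j) :
    IsConeLUB (GroupDirectSum.cone G P)
      {GroupDirectSum.single G i x, GroupDirectSum.single G j y}
      (GroupDirectSum.single G i x * GroupDirectSum.single G j y) := by
  refine isConeLUB_pair.2 ⟨coneLE_mul_right _ (single_mem_cone hy), ?_, fun w h1 h2 => ?_⟩
  · rw [(single_commute G hij x y).eq]
    exact coneLE_mul_right _ (single_mem_cone hx)
  · rw [single_coneLE_iff] at h2
    rw [coneLE_mul_left_iff, single_coneLE_iff]
    refine ⟨?_, fun k _ => h1 k⟩
    simpa [single_apply_of_ne hij.symm] using h2.1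

end DirectSum

/-! ### Positive words and their images -/

namespace GraphProduct

variable {V : Type u} {Γ : SimpleGraph V} {G : V → Type v} [∀ i, Group (G i)]
  {P : ∀ i, Submonoid (G i)}

theorem of_mem_cone {i : V} {x : G i} (hx : x ∈ P i) : of Γ G i x ∈ cone Γ G P :=
  Submonoid.subset_closure (Set.mem_iUnion.2 ⟨i, x, hx, rfl⟩)

theorem of_commute {i j : V} (h : Γ.Adj i j) (x : G i) (y : G j) :
    Commute (of Γ G i x) (of Γ G j y) := by
  have h1 : (QuotientGroup.mk' (Subgroup.normalClosure (graphProductRels Γ G)))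
      (CoprodI.of x * CoprodI.of y * (CoprodI.of x)⁻¹ * (CoprodI.of y)⁻¹) = 1 :=
    (QuotientGroup.eq_one_iff _).2 (Subgroup.subset_normalClosure ⟨i, j, h, x, y, rfl⟩)
  simp only [map_mul, map_inv, mul_inv_eq_iff_eq_mul, one_mul] at h1
  exact h1

/-- Induction on positive elements by left multiplication with positive elements of factors. -/
theorem cone_induction {motive : ∀ w : GraphProduct Γ G, w ∈ cone Γ G P → Prop}
    (one : motive 1 (Submonoid.one_mem _))
    (of_mul : ∀ i x (hx : x ∈ P i) w (hw : w ∈ cone Γ G P), motive w hw →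
      motive (of Γ G i x * w) (Submonoid.mul_mem _ (of_mem_cone hx) hw))
    {w : GraphProduct Γ G} (hw : w ∈ cone Γ G P) : motive w hw := by
  induction hw using Submonoid.closure_induction_left with
  | one => exact one
  | mul_left x hx y hy ih =>
    obtain ⟨i, a, ha, rfl⟩ := Set.mem_iUnion.1 hx
    exact of_mul i a ha y hy ih

theorem toDirectSum_mem_cone {w : GraphProduct Γ G} (hw : w ∈ cone Γ G P) :
    toDirectSum Γ G w ∈ GroupDirectSum.cone G P := by
  induction hw using cone_induction with
  | one => simp
  | of_mul i x hx w _ ih =>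
    rw [map_mul, toDirectSum_of]
    exact Submonoid.mul_mem _ (GroupDirectSum.single_mem_cone hx) ih

theorem toDirectSum_coneLE {x y : GraphProduct Γ G} (h : ConeLE (cone Γ G P) x y) :
    ConeLE (GroupDirectSum.cone G P) (toDirectSum Γ G x) (toDirectSum Γ G y) := by
  have := toDirectSum_mem_cone h
  rwa [map_mul, map_inv] at this

/-- Letters of a positive word cannot cancel in the direct sum, so all of them are trivial. -/
theorem eq_one_of_toDirectSum_eq_one (hP : ∀ i, IsPositiveCone (P i)) {w : GraphProduct Γ G}
    (hw : w ∈ cone Γ G P) (h : toDirectSum Γ G w = 1) : w = 1 := by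
  induction hw using cone_induction with
  | one => rfl
  | of_mul i x hx w hw ih =>
    rw [map_mul, toDirectSum_of] at h
    by_cases hx1 : x = 1
    · subst hx1
      simp only [map_one, one_mul] at h ⊢
      exact ih h
    · exact absurd h (GroupDirectSum.single_mul_ne_one hP hx hx1 (toDirectSum_mem_cone hw))

theorem isPositiveCone (hP : ∀ i, IsPositiveCone (P i)) : IsPositiveCone (cone Γ G P) := by
  refine fun w hw hw' => eq_one_of_toDirectSum_eq_one hP hw ?_
  refine GroupDirectSum.isPositiveCone hP _ (toDirectSum_mem_cone hw) ?_
  rw [← map_inv]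
  exact toDirectSum_mem_cone hw'

/-! ### The part of a positive element movable to the left end -/

section Head

variable (Γ G)

open Classical in
/-- The homomorphism of the factor at `j` to the free product of two copies of the direct sum,
used to construct the projection relative to a vertex `i`: the factor at `i` is sent to the
copy indexed by `true`, the factors at vertices adjacent to `i` are killed, and the remaining
ones are sent to the copy indexed by `false`. -/
noncomputable def vertexHom (i j : V) : G j →* CoprodI fun _ : Bool => GroupDirectSum G :=
  if j = i then (CoprodI.of (i := true)).comp (GroupDirectSum.single G j)
  else if Γ.Adj i j then 1
  else (CoprodI.of (i := false)).comp (GroupDirectSum.single G j)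

/-- The homomorphism from the graph product to a free product of two copies of the direct sum
which separates the vertex `i` from the vertices not adjacent to it and kills its link. -/
noncomputable def splitAt (i : V) :
    GraphProduct Γ G →* CoprodI fun _ : Bool => GroupDirectSum G :=
  QuotientGroup.lift _ (CoprodI.lift (vertexHom Γ G i)) <| by
    refine Subgroup.normalClosure_le_normal (N := MonoidHom.ker _) ?_
    rintro _ ⟨j, k, hjk, x, y, rfl⟩
    suffices h : Commute (vertexHom Γ G i j x) (vertexHom Γ G i k y) by
      simp only [SetLike.mem_coe, MonoidHom.mem_ker, map_mul, map_inv, CoprodI.lift_of]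
      rw [h.eq]
      group
    -- If one of the two vertices is `i`, the other lies in its link and is killed.
    by_cases hj : j = i
    · subst hj
      simp [vertexHom, hjk.ne', hjk]
    by_cases hk : k = i
    · subst hk
      simp [vertexHom, hjk.ne, hjk.symm]
    by_cases hij : Γ.Adj i j
    · simp [vertexHom, hj, hij]
    by_cases hik : Γ.Adj i k
    · simp [vertexHom, hk, hik]
    -- Both letters land in the same copy, where distinct coordinates commute.
    simp only [vertexHom, hj, hk, hij, hik, if_false]
    exact (GroupDirectSum.single_commute G hjk.ne x y).map
      (CoprodI.of (M := fun _ : Bool => GroupDirectSum G) (i := false))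

open Classical in
/-- The first syllable, in the copy of the direct sum indexed by `b`, of the image of an element
of the graph product under `splitAt`. -/
noncomputable def splitHead (i : V) (b : Bool) (w : GraphProduct Γ G) : GroupDirectSum G :=
  (CoprodI.Word.equivPair (M := fun _ : Bool => GroupDirectSum G) b
    (splitAt Γ G i w • CoprodI.Word.empty)).head

/-- The component of an element of the graph product at the vertex `i` which can be moved to its
left end. -/
noncomputable def head (i : V) (w : GraphProduct Γ G) : G i :=
  (splitHead Γ G i true w : ∀ i, G i) i

variable {Γ G}

theorem splitAt_of (i j : V) (x : G j) : splitAt Γ G i (of Γ G j x) = vertexHom Γ G i j x := by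
  simp [splitAt, of]

theorem splitHead_one (i : V) (b : Bool) : splitHead Γ G i b 1 = 1 := by
  simp [splitHead, CoprodI.Word.equivPair_head, CoprodI.Word.empty]

/-- A reduced word has only one first syllable. -/
theorem splitHead_eq_one_of_ne {i : V} {b c : Bool} (hbc : b ≠ c) {w : GraphProduct Γ G}
    (h : splitHead Γ G i b w ≠ 1) : splitHead Γ G i c w = 1 := by
  classical
  simp only [splitHead, CoprodI.Word.equivPair_head] at h ⊢
  split_ifs at h with h1
  · obtain ⟨h1, h2⟩ := h1
    exact dif_neg fun ⟨h3, h4⟩ => hbc (h2.symm.trans h4)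
  · exact absurd rfl h

theorem splitHead_of_mul_same (i : V) (x : G i) (w : GraphProduct Γ G) :
    splitHead Γ G i true (of Γ G i x * w) =
      GroupDirectSum.single G i x * splitHead Γ G i true w := by
  have h : vertexHom Γ G i i x = CoprodI.of (i := true) (GroupDirectSum.single G i x) := by
    simp [vertexHom]
  classical
  rw [splitHead, map_mul, splitAt_of, mul_smul, h, CoprodI.Word.equivPair_smul_same]
  rfl

theorem splitHead_of_mul_of_not_adj {i j : V} (hji : j ≠ i) (h : ¬ Γ.Adj i j) (x : G j)
    (w : GraphProduct Γ G) :
    splitHead Γ G i false (of Γ G j x * w) =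
      GroupDirectSum.single G j x * splitHead Γ G i false w := by
  have h : vertexHom Γ G i j x = CoprodI.of (i := false) (GroupDirectSum.single G j x) := by
    simp [vertexHom, hji, h]
  classical
  rw [splitHead, map_mul, splitAt_of, mul_smul, h, CoprodI.Word.equivPair_smul_same]
  rfl

theorem splitHead_of_mul_of_adj {i j : V} (h : Γ.Adj i j) (b : Bool) (x : G j)
    (w : GraphProduct Γ G) : splitHead Γ G i b (of Γ G j x * w) = splitHead Γ G i b w := by
  have h : vertexHom Γ G i j x = 1 := by simp [vertexHom, h.ne', h]
  rw [splitHead, map_mul, splitAt_of, h, one_mul]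
  rfl

theorem head_of_mul_same (i : V) (x : G i) (w : GraphProduct Γ G) :
    head Γ G i (of Γ G i x * w) = x * head Γ G i w := by
  simp [head, splitHead_of_mul_same]

theorem head_of_mul_of_adj {i j : V} (h : Γ.Adj i j) (x : G j) (w : GraphProduct Γ G) :
    head Γ G i (of Γ G j x * w) = head Γ G i w := by
  simp [head, splitHead_of_mul_of_adj h]

/-- The two copies must be treated together: a nontrivial positive letter outside the link leaves a
nontrivial first syllable in its own copy, which makes the other head trivial. -/
theorem splitHead_mem_cone (hP : ∀ i, IsPositiveCone (P i)) (i : V) {w : GraphProduct Γ G}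
    (hw : w ∈ cone Γ G P) (b : Bool) : splitHead Γ G i b w ∈ GroupDirectSum.cone G P := by
  induction hw using cone_induction generalizing b with
  | one => rw [splitHead_one]; exact Submonoid.one_mem _
  | of_mul j x hx w hw ih =>
    by_cases hx1 : x = 1
    · simpa [hx1] using ih b
    by_cases hij : Γ.Adj i j
    · rw [splitHead_of_mul_of_adj hij]; exact ih b
    obtain ⟨c, hc⟩ : ∃ c, splitHead Γ G i c (of Γ G j x * w) =
        GroupDirectSum.single G j x * splitHead Γ G i c w := by
      by_cases hji : j = i
      · subst hji
        exact ⟨true, splitHead_of_mul_same j x w⟩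
      · exact ⟨false, splitHead_of_mul_of_not_adj hji hij x w⟩
    by_cases hbc : b = c
    · subst hbc
      rw [hc]
      exact Submonoid.mul_mem _ (GroupDirectSum.single_mem_cone hx) (ih b)
    · rw [splitHead_eq_one_of_ne (Ne.symm hbc)]
      · exact Submonoid.one_mem _
      · rw [hc]
        exact GroupDirectSum.single_mul_ne_one hP hx hx1 (ih c)

theorem head_mem (hP : ∀ i, IsPositiveCone (P i)) (i : V) {w : GraphProduct Γ G}
    (hw : w ∈ cone Γ G P) : head Γ G i w ∈ P i :=
  splitHead_mem_cone hP i hw true i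

/-- By positivity the new letter is not cancelled, so the reduced word starts in the copy `false`.
-/
theorem head_of_mul_of_not_adj (hP : ∀ i, IsPositiveCone (P i)) {i j : V} (hji : j ≠ i)
    (h : ¬ Γ.Adj i j) {x : G j} (hx : x ∈ P j) (hx1 : x ≠ 1) {w : GraphProduct Γ G}
    (hw : w ∈ cone Γ G P) : head Γ G i (of Γ G j x * w) = 1 := by
  rw [head, splitHead_eq_one_of_ne (b := false) (by simp)]
  · rfl
  · rw [splitHead_of_mul_of_not_adj hji h]
    exact GroupDirectSum.single_mul_ne_one hP hx hx1 (splitHead_mem_cone hP i hw false)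

theorem of_head_coneLE (hP : ∀ i, IsPositiveCone (P i)) (i : V) {w : GraphProduct Γ G}
    (hw : w ∈ cone Γ G P) : ConeLE (cone Γ G P) (of Γ G i (head Γ G i w)) w := by
  induction hw using cone_induction with
  | one => simp [head, splitHead_one, ConeLE.refl]
  | of_mul j x hx w hw ih =>
    by_cases hx1 : x = 1
    · simpa [hx1] using ih
    by_cases hij : Γ.Adj i j
    · rw [head_of_mul_of_adj hij, ConeLE, ← mul_assoc, ← map_inv, (of_commute hij _ x).eq,
        mul_assoc, map_inv]
      exact Submonoid.mul_mem _ (of_mem_cone hx) ih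
    by_cases hji : j = i
    · subst hji
      rw [head_of_mul_same, map_mul, coneLE_mul_left_iff, inv_mul_cancel_left]
      exact ih
    · rw [head_of_mul_of_not_adj hP hji hij hx hx1 hw, map_one, one_coneLE]
      exact Submonoid.mul_mem _ (of_mem_cone hx) hw

theorem of_mono (i : V) {x y : G i} (h : ConeLE (P i) x y) :
    ConeLE (cone Γ G P) (of Γ G i x) (of Γ G i y) := by
  rw [ConeLE, ← map_inv, ← map_mul]
  exact of_mem_cone h

/-- A positive element is bounded below by an element of a factor precisely when its head at the
corresponding vertex is. -/
theorem of_coneLE_iff (hP : ∀ i, IsPositiveCone (P i)) {i : V} {x : G i}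
    {w : GraphProduct Γ G} (hw : w ∈ cone Γ G P) :
    ConeLE (cone Γ G P) (of Γ G i x) w ↔ ConeLE (P i) x (head Γ G i w) := by
  refine ⟨fun h => ?_, fun h => (of_mono i h).trans (of_head_coneLE hP i hw)⟩
  -- The quotient by `of x` is positive, and its head is `x⁻¹` times that of `w`.
  have h1 := head_mem hP i h
  rwa [← map_inv, head_of_mul_same] at h1

end Head

/-! ### Construction of joins preserved by the homomorphism -/

section LeastUpperBounds

variable (P) in
/-- `z` is a least upper bound of `x` and `y` which is preserved by the homomorphism to the
direct sum. -/
def IsPreservedLUB (x y z : GraphProduct Γ G) : Prop :=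
  IsConeLUB (cone Γ G P) {x, y} z ∧
    IsConeLUB (GroupDirectSum.cone G P) {toDirectSum Γ G x, toDirectSum Γ G y} (toDirectSum Γ G z)

theorem IsPreservedLUB.symm {x y z : GraphProduct Γ G} (h : IsPreservedLUB P x y z) :
    IsPreservedLUB P y x z :=
  ⟨h.1.pair_comm, h.2.pair_comm⟩

theorem isPreservedLUB_one_left {y : GraphProduct Γ G} (hy : y ∈ cone Γ G P) :
    IsPreservedLUB P 1 y y :=
  ⟨isConeLUB_one_left hy, by rw [map_one]; exact isConeLUB_one_left (toDirectSum_mem_cone hy)⟩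

theorem IsPreservedLUB.mul_left {a x y b z : GraphProduct Γ G} (hx : x ∈ cone Γ G P)
    (h : IsPreservedLUB P a y (a * b)) (h' : IsPreservedLUB P x b z) :
    IsPreservedLUB P (a * x) y (a * z) := by
  refine ⟨h.1.mul_left hx h'.1, ?_⟩
  rw [map_mul, map_mul]
  exact IsConeLUB.mul_left (toDirectSum_mem_cone hx) (by simpa using h.2) h'.2

/-- Bounded pairs of positive elements of factors have least upper bounds, whose quotients by
the given elements are again positive elements of factors. -/
theorem exists_isPreservedLUB_of_of (hP : ∀ i, IsQuasiLatticeOrdered (P i)) {i j : V} {x : G i}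
    {y : G j} (hx : x ∈ P i) (hy : y ∈ P j) {w : GraphProduct Γ G}
    (hxw : ConeLE (cone Γ G P) (of Γ G i x) w) (hyw : ConeLE (cone Γ G P) (of Γ G j y) w) :
    ∃ k, ∃ c ∈ P k, ∃ l, ∃ d ∈ P l, of Γ G i x * of Γ G k c = of Γ G j y * of Γ G l d ∧
      IsPreservedLUB P (of Γ G i x) (of Γ G j y) (of Γ G i x * of Γ G k c) := by
  have hP' := fun i => (hP i).isPositiveCone
  have hw := hxw.mem (of_mem_cone hx)
  by_cases hij : i = j
  · subst hij
    obtain ⟨z, hz⟩ := (hP i).exists_lub {x, y} (by simp) (by simp)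
      ⟨head Γ G i w, isConeUpperBound_pair.2
        ⟨(of_coneLE_iff hP' hw).1 hxw, (of_coneLE_iff hP' hw).1 hyw⟩⟩
    have hz' := isConeLUB_pair.1 hz
    refine ⟨i, x⁻¹ * z, hz'.1, i, y⁻¹ * z, hz'.2.1, by simp, ?_⟩
    rw [← map_mul, mul_inv_cancel_left]
    refine ⟨isConeLUB_pair.2 ⟨of_mono i hz'.1, of_mono i hz'.2.1, fun u h1 h2 => ?_⟩, ?_⟩
    · have hu := h1.mem (of_mem_cone hx)
      rw [of_coneLE_iff hP' hu] at *
      exact hz'.2.2 _ h1 h2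
    · simp only [toDirectSum_of]
      exact GroupDirectSum.isConeLUB_single_same hz
  by_cases hadj : Γ.Adj i j
  · refine ⟨j, y, hy, i, x, hx, (of_commute hadj x y).eq, ?_, ?_⟩
    · refine isConeLUB_pair.2 ⟨coneLE_mul_right _ (of_mem_cone hy), ?_, fun u h1 h2 => ?_⟩
      · rw [(of_commute hadj x y).eq]
        exact coneLE_mul_right _ (of_mem_cone hx)
      · rw [of_coneLE_iff hP' (h1.mem (of_mem_cone hx))] at h2
        -- Removing `x` from the left does not change the head at the adjacent vertex `j`.
        rw [coneLE_mul_left_iff, of_coneLE_iff hP' h1, ← map_inv, head_of_mul_of_adj hadj.symm]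
        exact h2
    · simp only [map_mul, toDirectSum_of]
      exact GroupDirectSum.isConeLUB_single_of_ne hij hx hy
  by_cases hx1 : x = 1
  · subst hx1
    refine ⟨j, y, hy, j, 1, (P j).one_mem, by simp, ?_⟩
    simpa using isPreservedLUB_one_left (of_mem_cone hy)
  by_cases hy1 : y = 1
  · subst hy1
    refine ⟨i, 1, (P i).one_mem, i, x, hx, by simp, ?_⟩
    simpa using (isPreservedLUB_one_left (of_mem_cone hx)).symm
  · exfalso
    -- As `w` starts with the nontrivial `y`, its head at `i` is 1, forcing `x = 1`.
    have h1 := head_of_mul_of_not_adj hP' (Ne.symm hij) hadj hy hy1 hyw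
    rw [mul_inv_cancel_left] at h1
    have h2 := (of_coneLE_iff hP' hw).1 hxw
    rw [h1] at h2
    exact hx1 (hP' i x hx (by simpa [ConeLE] using h2))

/-- The complement of `y` in the join stays a single letter, so it can be carried through `y` one
letter at a time. -/
theorem exists_isPreservedLUB_of (hP : ∀ i, IsQuasiLatticeOrdered (P i))
    {y : GraphProduct Γ G} (hy : y ∈ cone Γ G P) {i : V} {x : G i} (hx : x ∈ P i)
    {w : GraphProduct Γ G} (hxw : ConeLE (cone Γ G P) (of Γ G i x) w)
    (hyw : ConeLE (cone Γ G P) y w) :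
    ∃ k, ∃ c ∈ P k, IsPreservedLUB P (of Γ G i x) y (y * of Γ G k c) := by
  induction hy using cone_induction generalizing i w with
  | one =>
    refine ⟨i, x, hx, ?_⟩
    rw [one_mul]
    exact (isPreservedLUB_one_left (of_mem_cone hx)).symm
  | of_mul j b hb y hy ih =>
    have hbw := (coneLE_mul_right (of Γ G j b) hy).trans hyw
    obtain ⟨k, c, hc, l, d, hd, hcd, h⟩ := exists_isPreservedLUB_of_of hP hx hb hxw hbw
    rw [hcd] at h
    have h1 := (isConeLUB_pair.1 h.1).2.2 w hxw hbw
    rw [coneLE_mul_left_iff] at h1 hyw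
    -- The complement `d` of `b` is now joined with the rest of the word, below `b⁻¹ * w`.
    obtain ⟨m, e, he, h2⟩ := ih hd h1 hyw
    refine ⟨m, e, he, ?_⟩
    rw [mul_assoc]
    exact (h.symm.mul_left hy h2.symm).symm

theorem exists_isPreservedLUB (hP : ∀ i, IsQuasiLatticeOrdered (P i))
    {x y : GraphProduct Γ G} (hx : x ∈ cone Γ G P) (hy : y ∈ cone Γ G P)
    {w : GraphProduct Γ G} (hxw : ConeLE (cone Γ G P) x w) (hyw : ConeLE (cone Γ G P) y w) :
    ∃ z, IsPreservedLUB P x y z := by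
  induction hx using cone_induction generalizing y w with
  | one => exact ⟨y, isPreservedLUB_one_left hy⟩
  | of_mul i a ha x hx ih =>
    have haw := (coneLE_mul_right (of Γ G i a) hx).trans hxw
    obtain ⟨k, c, hc, h⟩ := exists_isPreservedLUB_of hP hy ha haw hyw
    obtain ⟨h1, -, h2⟩ := isConeLUB_pair.1 h.1
    have h3 := h2 w haw hyw
    -- The join is written as `a` times its complement, which is then joined with the rest of `x`.
    rw [← mul_inv_cancel_left (of Γ G i a) (y * of Γ G k c)] at h h3
    rw [coneLE_mul_left_iff] at h3 hxw
    obtain ⟨z, hz⟩ := ih h1 hxw h3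
    exact ⟨_, h.mul_left hx hz⟩

end LeastUpperBounds

end GraphProduct

theorem mainTheorem3 {V : Type u} (Γ : SimpleGraph V) (G : V → Type v) [∀ i, Group (G i)]
    (P : ∀ i, Submonoid (G i)) (hP : ∀ i, IsQuasiLatticeOrdered (P i)) :
    -- the canonical homomorphism is order preserving
    (∀ x y : GraphProduct Γ G, ConeLE (GraphProduct.cone Γ G P) x y →
      ConeLE (GroupDirectSum.cone G P)
        (GraphProduct.toDirectSum Γ G x) (GraphProduct.toDirectSum Γ G y)) ∧
    -- for positive elements with a common positive upper bound:
    ∀ x ∈ GraphProduct.cone Γ G P, ∀ y ∈ GraphProduct.cone Γ G P,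
      (∃ z ∈ GraphProduct.cone Γ G P, IsConeUpperBound (GraphProduct.cone Γ G P) {x, y} z) →
      -- (a) the homomorphism separates them
      (GraphProduct.toDirectSum Γ G x = GraphProduct.toDirectSum Γ G y → x = y) ∧
      -- (b) the unique least upper bound exists and is mapped to that of the images
      ∃ z : GraphProduct Γ G,
        (∀ w, IsConeLUB (GraphProduct.cone Γ G P) {x, y} w ↔ w = z) ∧
        (∀ w, IsConeLUB (GroupDirectSum.cone G P)
          {GraphProduct.toDirectSum Γ G x, GraphProduct.toDirectSum Γ G y} w ↔
            w = GraphProduct.toDirectSum Γ G z) := by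
  have hP' := fun i => (hP i).isPositiveCone
  refine ⟨fun x y => GraphProduct.toDirectSum_coneLE, fun x hx y hy ⟨w, _, hw⟩ => ?_⟩
  rw [isConeUpperBound_pair] at hw
  obtain ⟨z, hz, hz'⟩ := GraphProduct.exists_isPreservedLUB hP hx hy hw.1 hw.2
  refine ⟨fun h => ?_, z, (GraphProduct.isPositiveCone hP').isConeLUB_iff_eq hz,
    (GroupDirectSum.isPositiveCone hP').isConeLUB_iff_eq hz'⟩
  obtain ⟨hxz, hyz, -⟩ := isConeLUB_pair.1 hz
  -- The images of `x` and `y` coincide, so their join is that common image. Hence `x⁻¹ * z` and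
  -- `y⁻¹ * z` are positive with trivial image.
  have h1 : GraphProduct.toDirectSum Γ G z = GraphProduct.toDirectSum Γ G x := by
    refine ((GroupDirectSum.isPositiveCone hP').isConeLUB_iff_eq hz' _).1 ?_ |>.symm
    rw [← h]
    exact isConeLUB_pair.2 ⟨.refl _ _, .refl _ _, fun _ h _ => h⟩
  have h2 := GraphProduct.eq_one_of_toDirectSum_eq_one hP' hxz (by simp [h1])
  have h3 := GraphProduct.eq_one_of_toDirectSum_eq_one hP' hyz (by simp [h1, h])
  rw [inv_mul_eq_one] at h2 h3
  rw [h2, h3]
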